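/- Let $d\in\{2,3\}$, $X_1,\dots,X_d>0$, and let $\mathbb{T}^d=\prod_{i=1}^d[-X_i,X_i]$ be the periodic box, with volume $|\mathbb{T}^d|$. Let $W(s)=18(s^2-s)^2$, $f(s)=3s^2-2s^3$, $L_{W''}=\|W''\|_{L^\infty[0,1]}$, $L_{f''}=\|f''\|_{L^\infty[0,1]}$. Let $\varepsilon,\gamma,\kappa>0$, $M\ge 0$, $\omega\in(0,1)$, $\tilde\omega=\max\{\omega,1-\omega\}$, $T>0$, $N\ge 1$ an integer and $\tau=T/N$. For a periodic $g\in L^2(\mathbb{T}^d)$ let $(-\Delta)^{-1}g$ be the periodic mean-zero solution $u$ of $-\Delta u=g-|\mathbb{T}^d|^{-1}\int_{\mathbb{T}^d}g\,dx$, and let $\|(-\Delta)^{-1}\|$ be the norm of this operator from $L^\infty(\mathbb{T}^d)$ to itself. For a measurable periodic $\psi$ with values in $[0,1]$ put $$\mathcal{F}(\psi)=\Big(1+\frac{\tau\kappa}{\varepsilon}\Big)\psi-\frac{\tau}{\varepsilon}W'(\psi)-\tau\gamma\,(-\Delta)^{-1}(f(\psi)-\omega)\,f'(\psi)-\tau M\int_{\mathbb{T}^d}(f(\psi)-\omega)\,dx\;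 f'(\psi).$$ Assume $$\frac1\tau+\frac\kappa\varepsilon\ \ge\ \frac{L_{W''}}{\varepsilon}+\tilde\omega L_{f''}\Big(\gamma\|(-\Delta)^{-1}\|+M|\mathbb{T}^d|\Big).$$ (i) For every measurable periodic $\psi$ with $0\le\psi\le1$ a.e. one has $0\le\mathcal{F}(\psi)\le 1+\tau\kappa/\varepsilon$ a.e., and each of the two bounds is attained, in the sense that there are such $\psi$ with $\mathcal{F}(\psi)=0$ a.e. and with $\mathcal{F}(\psi)=1+\tau\kappa/\varepsilon$ a.e. (ii) Let $\phi^0$ be measurable and periodic with $0\le\phi^0\le1$ a.e., and let $\phi^1,\dots,\phi^N$ be periodic functions in $H^2(\mathbb{T}^d)$ which solve, for $0\le n<N$, the stabilized time-discrete semi-implicit scheme $$\Big(\frac1\tau+\frac\kappa\varepsilon\Big)(\phi^{n+1}-\phi^n)=\varepsilon\Delta\phi^{n+1}-\frac1\varepsilon W'(\phi^n)-\gamma(-\Delta)^{-1}(f(\phi^n)-\omega)f'(\phi^n)-M\int_{\mathbb{T}^d}(f(\phi^n)-\omega)\,dx\; f'(\phi^n)$$ a.e. in $\mathbb{T}^d$,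 or, in its rewritten form, $\big((1+\tau\kappa/\varepsilon)I-\tau\varepsilon\Delta\big)\phi^{n+1}=\mathcal{F}(\phi^n)$. Then $0\le\phi^n\le1$ a.e. for all $n\in\{1,\dots,N\}$. -/

import Mathlib

open MeasureTheory Set
open scoped ENNReal

noncomputable section

namespace PACOK

/-- The double well potential `W(s) = 18 (s² - s)²`. -/
def W (s : ℝ) : ℝ := 18 * (s ^ 2 - s) ^ 2

/-- The nonlinearity `f(s) = 3 s² - 2 s³`. -/
def f (s : ℝ) : ℝ := 3 * s ^ 2 - 2 * s ^ 3

/-- The supremum of `|g|` on `[0,1]`. It is applied to continuous functions only, for which it is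
the norm of `L^∞[0,1]`. -/
def supNormUnit (g : ℝ → ℝ) : ℝ := sSup ((fun s => |g s|) '' Icc (0 : ℝ) 1)

/-- `L_{W''} = ‖W''‖_{L^∞[0,1]}`. -/
def LW : ℝ := supNormUnit (iteratedDeriv 2 W)

/-- `L_{f''} = ‖f''‖_{L^∞[0,1]}`. -/
def Lf : ℝ := supNormUnit (iteratedDeriv 2 f)

/-- `max {ω, 1 - ω}`. -/
def omegaTilde (ω : ℝ) : ℝ := max ω (1 - ω)

variable {d : ℕ}

/-- The box `∏ᵢ [-Xᵢ, Xᵢ]` in `ℝ^d`. -/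
def box (X : Fin d → ℝ) : Set (EuclideanSpace ℝ (Fin d)) :=
  {x | ∀ i, x i ∈ Icc (-X i) (X i)}

/-- Lebesgue measure on the box. -/
def boxMeasure (X : Fin d → ℝ) : Measure (EuclideanSpace ℝ (Fin d)) :=
  volume.restrict (box X)

/-- Functions on the periodic box: functions on `ℝ^d` with period `2 Xᵢ` in the `i`-th variable. -/
def IsPeriodic (X : Fin d → ℝ) (u : EuclideanSpace ℝ (Fin d) → ℝ) : Prop :=
  ∀ i, Function.Periodic u (EuclideanSpace.single i (2 * X i))

/-- `Δ u = g` in the sense of distributions on the periodic box, for `u`, `g` in `L²`: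
`∫ u Δη = ∫ g η` for all smooth periodic test functions `η`. -/
def HasWeakLaplacian (X : Fin d → ℝ) (u g : EuclideanSpace ℝ (Fin d) → ℝ) : Prop :=
  ∀ η : EuclideanSpace ℝ (Fin d) → ℝ, ContDiff ℝ (⊤ : ℕ∞) η → IsPeriodic X η →
    ∫ x, u x * Laplacian.laplacian η x ∂(boxMeasure X) = ∫ x, g x * η x ∂(boxMeasure X)

/-- `u` is the periodic solution with mean zero of `-Δ u = g - ⨍ g`. A periodic `u` in `L²` whose
distributional Laplacian is in `L²` belongs to the periodic Sobolev space `H²`. -/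
structure IsInvNegLaplacian (X : Fin d → ℝ) (g u : EuclideanSpace ℝ (Fin d) → ℝ) : Prop where
  periodic : IsPeriodic X u
  memLp : MemLp u 2 (boxMeasure X)
  mean_zero : ∫ x, u x ∂(boxMeasure X) = 0
  eqn : HasWeakLaplacian X u (fun x => -(g x - ⨍ y, g y ∂(boxMeasure X)))

open Classical in
/-- The operator `(-Δ)⁻¹` on the periodic box. The kernel of `-Δ` consists of the constants;
`(-Δ)⁻¹ g` is the mean-zero solution `u` of `-Δ u = g - ⨍ g` (it exists, and is unique up to null
sets, for every periodic `g` in `L²`). In Fourier series,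
`(-Δ)⁻¹ g = ∑_{k ≠ 0} λ_k⁻¹ ĝ(k) e_k`. -/
def invNegLaplacian (X : Fin d → ℝ) (g : EuclideanSpace ℝ (Fin d) → ℝ) :
    EuclideanSpace ℝ (Fin d) → ℝ :=
  if h : ∃ u, IsInvNegLaplacian X g u then h.choose else 0

/-- The norm of `(-Δ)⁻¹` as an operator from `L^∞` of the periodic box to itself: the optimal
constant `C` in `‖(-Δ)⁻¹ g‖_{L^∞} ≤ C ‖g‖_{L^∞}`. -/
def invNegLaplacianNorm (X : Fin d → ℝ) : ℝ :=
  sInf {C : ℝ | 0 ≤ C ∧ ∀ g : EuclideanSpace ℝ (Fin d) → ℝ,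
    IsPeriodic X g → MemLp g ∞ (boxMeasure X) →
      eLpNorm (invNegLaplacian X g) ∞ (boxMeasure X) ≤
        ENNReal.ofReal C * eLpNorm g ∞ (boxMeasure X)}

/-- A measurable function on the periodic box with values in `[0,1]` almost everywhere. -/
structure IsUnitValued (X : Fin d → ℝ) (ψ : EuclideanSpace ℝ (Fin d) → ℝ) : Prop where
  periodic : IsPeriodic X ψ
  aestronglyMeasurable : AEStronglyMeasurable ψ (boxMeasure X)
  mem_Icc : ∀ᵐ x ∂(boxMeasure X), ψ x ∈ Icc (0 : ℝ) 1

/-- The explicit right-hand side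
`𝓕(ψ) = (1 + τκ/ε) ψ - (τ/ε) W'(ψ) - τγ (-Δ)⁻¹(f(ψ) - ω) f'(ψ) - τM (∫ (f(ψ) - ω)) f'(ψ)`. -/
def rhs (X : Fin d → ℝ) (ε γ M ω κ τ : ℝ) (ψ : EuclideanSpace ℝ (Fin d) → ℝ) :
    EuclideanSpace ℝ (Fin d) → ℝ := fun x =>
  (1 + τ * κ / ε) * ψ x - τ / ε * deriv W (ψ x)
    - τ * γ * invNegLaplacian X (fun y => f (ψ y) - ω) x * deriv f (ψ x)
    - τ * M * (∫ y, (f (ψ y) - ω) ∂(boxMeasure X)) * deriv f (ψ x)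

/-- One step `φ ↦ φ'` of the stabilized semi-implicit scheme: `φ'` is a periodic `H²` function
(`L` is its Laplacian) and satisfies
`(1/τ + κ/ε)(φ' - φ) = ε Δφ' - (1/ε) W'(φ) - γ (-Δ)⁻¹(f(φ) - ω) f'(φ) - M (∫ (f(φ) - ω)) f'(φ)`. -/
def SchemeStep (X : Fin d → ℝ) (ε γ M ω κ τ : ℝ) (φ φ' : EuclideanSpace ℝ (Fin d) → ℝ) : Prop :=
  IsPeriodic X φ' ∧ MemLp φ' 2 (boxMeasure X) ∧
  ∃ L : EuclideanSpace ℝ (Fin d) → ℝ,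
    MemLp L 2 (boxMeasure X) ∧ HasWeakLaplacian X φ' L ∧
    ∀ᵐ x ∂(boxMeasure X),
      (1 / τ + κ / ε) * (φ' x - φ x) =
        ε * L x - 1 / ε * deriv W (φ x)
          - γ * invNegLaplacian X (fun y => f (φ y) - ω) x * deriv f (φ x)
          - M * (∫ y, (f (φ y) - ω) ∂(boxMeasure X)) * deriv f (φ x)

/-- One step of the scheme in the rewritten form `((1 + τκ/ε) I - τε Δ) φ' = 𝓕(φ)`. -/
def SchemeStep' (X : Fin d → ℝ) (ε γ M ω κ τ : ℝ) (φ φ' : EuclideanSpace ℝ (Fin d) → ℝ) : Prop :=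
  IsPeriodic X φ' ∧ MemLp φ' 2 (boxMeasure X) ∧
  ∃ L : EuclideanSpace ℝ (Fin d) → ℝ,
    MemLp L 2 (boxMeasure X) ∧ HasWeakLaplacian X φ' L ∧
    ∀ᵐ x ∂(boxMeasure X),
      (1 + τ * κ / ε) * φ' x - τ * ε * L x = rhs X ε γ M ω κ τ φ x

end PACOK

end

section TorusFourier

open MeasureTheory Set
open scoped ENNReal

attribute [local instance] instMeasureSpaceUnitAddCircle

namespace PACOK

variable {d : ℕ}

/-! Two facts combine. Pointwise, `W'` and `f'` vanish at both 0 and 1, so on `[0,1]` they are at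
most `LW * r` and `Lf * r` with `r` the distance to either endpoint. The nonlocal coefficients are
bounded through `|f - ω| ≤ omegaTilde ω`, and the stabilization condition then makes the total
perturbation at most `(1 + τκ/ε) r`. Taking `r = s` gives the lower bound and `r = 1 - s` the upper
one (`mem_Icc_of_le_stabilization`, `rhs_mem_Icc`); the constants 0 and 1 attain them. Next, `c -
aΔ` with `c > 0`, `a ≥ 0` obeys a maximum principle, so the bounds pass to the next iterate, and
induction concludes.

The maximum principle is needed for weak solutions and is proved by duality
(`ae_le_of_mul_le_sub_laplacian`). A nonnegative trigonometric polynomial `p` is `cη - aΔη` for a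
smooth periodic `η`, and `η ≥ 0` by the classical principle at a minimum point. Testing with `η`
gives `∫ (φ - m) p ≥ 0`, and density of trigonometric polynomials yields `φ ≥ m`.

The operator norm is an infimum of admissible constants, so it is a bound only if some constant is
admissible. One comes from Fourier series: in dimension at most 3 the squares of the inverse
eigenvalues are summable, and Cauchy-Schwarz with Parseval bounds `(-Δ)⁻¹` from `L²` to `L^∞`
(`IsInvNegLaplacian.ae_abs_le`). -/

instance isProbabilityMeasure_unitAddCircle :
    IsProbabilityMeasure (volume : Measure UnitAddCircle) :=
  inferInstanceAs (IsProbabilityMeasure AddCircle.haarAddCircle)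

/-! ### The box as a fundamental domain of the torus. -/

/-- The measurable section of the covering map of the torus with values in the box. -/
noncomputable def boxSection (X : Fin d → ℝ) (y : UnitAddTorus (Fin d)) :
    EuclideanSpace ℝ (Fin d) :=
  WithLp.toLp 2 fun i =>
    2 * X i * (UnitAddTorus.measurableEquivPiIoc (fun _ : Fin d => (-(1 / 2) : ℝ)) y).1 i

/-- The covering map onto the standard torus, which identifies points of the periodic box. -/
noncomputable def torusProj (X : Fin d → ℝ) (x : EuclideanSpace ℝ (Fin d)) :
    UnitAddTorus (Fin d) :=
  fun i => ((x i / (2 * X i) : ℝ) : UnitAddCircle)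

/-- The volume of the box. -/
noncomputable def boxVolume (X : Fin d → ℝ) : ℝ := ∏ i, (2 * X i)

lemma boxVolume_pos {X : Fin d → ℝ} (hX : ∀ i, 0 < X i) : 0 < boxVolume X :=
  Finset.prod_pos fun i _ => by have := hX i; positivity

lemma torusProj_boxSection {X : Fin d → ℝ} (hX : ∀ i, 0 < X i) (y : UnitAddTorus (Fin d)) :
    torusProj X (boxSection X y) = y := by
  ext i
  have h : (2 * X i) ≠ 0 := by have := hX i; positivity
  simp only [torusProj, boxSection, UnitAddTorus.coe_measurableEquivPiIoc_apply]
  rw [mul_div_cancel_left₀ _ h]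
  exact (AddCircle.equivIoc 1 (-(1 / 2) : ℝ)).symm_apply_apply (y i)

lemma measurableEmbedding_scale {X : Fin d → ℝ} (hX : ∀ i, 0 < X i) :
    MeasurableEmbedding fun x : Fin d → ℝ => fun i => 2 * X i * x i := by
  refine Measurable.measurableEmbedding (by fun_prop) fun x y h => ?_
  ext i
  have h' : (2 * X i) ≠ 0 := by have := hX i; positivity
  exact mul_left_cancel₀ h' (congrFun h i)

lemma measurableEmbedding_boxSection {X : Fin d → ℝ} (hX : ∀ i, 0 < X i) :
    MeasurableEmbedding (boxSection X) := by
  have hm : MeasurableSet {x : Fin d → ℝ | ∀ i, x i ∈ Ioc (-(1 / 2) : ℝ) (-(1 / 2) + 1)} :=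
    MeasurableSet.univ_pi' fun i => measurableSet_Ioc
  exact (MeasurableEquiv.toLp 2 (Fin d → ℝ)).measurableEmbedding.comp
    ((measurableEmbedding_scale hX).comp ((MeasurableEmbedding.subtype_coe hm).comp
      (UnitAddTorus.measurableEquivPiIoc fun _ : Fin d => (-(1 / 2) : ℝ)).measurableEmbedding))

lemma map_scale_volume {X : Fin d → ℝ} (hX : ∀ i, 0 < X i) :
    ENNReal.ofReal (boxVolume X) •
      Measure.map (fun x : Fin d → ℝ => fun i => 2 * X i * x i) volume = volume := by
  classical
  have h0 : (Matrix.diagonal fun i => 2 * X i).det = boxVolume X := by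
    rw [Matrix.det_diagonal]; rfl
  have h := Real.smul_map_diagonal_volume_pi (D := fun i => 2 * X i)
    (by rw [h0]; exact (boxVolume_pos hX).ne')
  rw [h0, abs_of_pos (boxVolume_pos hX)] at h
  convert h using 3
  ext x i
  simp [Matrix.mulVec_diagonal]

/-- Lebesgue measure on the box is a multiple of the image of the Haar measure of the torus. -/
lemma boxMeasure_eq_map {X : Fin d → ℝ} (hX : ∀ i, 0 < X i) :
    boxMeasure X = ENNReal.ofReal (boxVolume X) • Measure.map (boxSection X) volume := by
  have hm : MeasurableSet {x : Fin d → ℝ | ∀ i, x i ∈ Ioc (-(1 / 2) : ℝ) (-(1 / 2) + 1)} :=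
    MeasurableSet.univ_pi' fun i => measurableSet_Ioc
  have hs := (measurableEmbedding_scale hX).measurable
  have e1 : Measure.map (boxSection X) volume =
      Measure.map (MeasurableEquiv.toLp 2 (Fin d → ℝ))
        (Measure.map (fun x : Fin d → ℝ => fun i => 2 * X i * x i)
          (volume.restrict {x : Fin d → ℝ | ∀ i, x i ∈ Ioc (-(1 / 2) : ℝ) (-(1 / 2) + 1)})) := by
    rw [← map_comap_subtype_coe hm, ← (UnitAddTorus.measurePreserving_equivPiIoc _).map_eq,
      Measure.map_map measurable_subtype_coe (MeasurableEquiv.measurable _),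
      Measure.map_map hs (measurable_subtype_coe.comp (MeasurableEquiv.measurable _)),
      Measure.map_map (MeasurableEquiv.measurable _)
        (hs.comp (measurable_subtype_coe.comp (MeasurableEquiv.measurable _)))]
    rfl
  have e2 : {x : Fin d → ℝ | ∀ i, x i ∈ Ioc (-(1 / 2) : ℝ) (-(1 / 2) + 1)} =
      (fun x : Fin d → ℝ => fun i => 2 * X i * x i) ⁻¹'
        (univ.pi fun i => Ioc (-X i) (X i)) := by
    ext x
    simp only [mem_ofPred_eq, mem_preimage, mem_pi, mem_univ, true_imp_iff, mem_Ioc]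
    refine forall_congr' fun i => ?_
    have := hX i
    constructor <;> rintro ⟨h1, h2⟩ <;> constructor <;> nlinarith
  have hI : MeasurableSet (univ.pi fun i => Ioc (-X i) (X i)) :=
    MeasurableSet.univ_pi fun i => measurableSet_Ioc
  rw [e1, e2, ← Measure.restrict_map hs hI, ← Measure.map_smul, ← Measure.restrict_smul,
    map_scale_volume hX]
  -- The section takes values in the half-open box; the missing faces of the closed box are null.
  have e3 : (volume : Measure (Fin d → ℝ)).restrict (univ.pi fun i => Ioc (-X i) (X i)) =
      volume.restrict (MeasurableEquiv.toLp 2 (Fin d → ℝ) ⁻¹' box X) := by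
    have e4 : MeasurableEquiv.toLp 2 (Fin d → ℝ) ⁻¹' box X = Icc (-X) X := by
      ext x
      simp only [box, mem_preimage, mem_ofPred_eq, mem_Icc, Pi.le_def, ← forall_and]
      rfl
    rw [e4]
    exact Measure.restrict_congr_set
      (Measure.univ_pi_Ioc_ae_eq_Icc (μ := fun _ : Fin d => volume) (f := -X) (g := X))
  have e5 : (volume : Measure (EuclideanSpace ℝ (Fin d))) =
      Measure.map (MeasurableEquiv.toLp 2 (Fin d → ℝ)) volume :=
    (PiLp.volume_preserving_toLp (Fin d)).map_eq.symm
  rw [e3, boxMeasure, e5, MeasurableEquiv.restrict_map]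

instance isFiniteMeasure_boxMeasure (X : Fin d → ℝ) : IsFiniteMeasure (boxMeasure X) := by
  have hb : Bornology.IsBounded (box X) := by
    have h : Bornology.IsBounded ((EuclideanSpace.equiv (Fin d) ℝ).symm '' Icc (-X) X) :=
      (isCompact_Icc.image (EuclideanSpace.equiv (Fin d) ℝ).symm.continuous).isBounded
    refine h.subset fun x hx => ⟨x.ofLp, ?_, rfl⟩
    exact ⟨fun i => (hx i).1, fun i => (hx i).2⟩
  exact ⟨by rw [boxMeasure, Measure.restrict_apply_univ]; exact hb.measure_lt_top⟩

lemma integral_boxMeasure {E : Type*} [NormedAddCommGroup E] [NormedSpace ℝ E] {X : Fin d → ℝ}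
    (hX : ∀ i, 0 < X i) (G : EuclideanSpace ℝ (Fin d) → E) :
    ∫ x, G x ∂(boxMeasure X) = boxVolume X • ∫ y, G (boxSection X y) := by
  rw [boxMeasure_eq_map hX, integral_smul_measure, (measurableEmbedding_boxSection hX).integral_map,
    ENNReal.toReal_ofReal (boxVolume_pos hX).le]

lemma ae_boxMeasure_iff {X : Fin d → ℝ} (hX : ∀ i, 0 < X i)
    {p : EuclideanSpace ℝ (Fin d) → Prop} :
    (∀ᵐ x ∂(boxMeasure X), p x) ↔ ∀ᵐ y : UnitAddTorus (Fin d), p (boxSection X y) := by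
  rw [boxMeasure_eq_map hX, Measure.ae_ennreal_smul_measure_iff
    (by simpa using boxVolume_pos hX), (measurableEmbedding_boxSection hX).ae_map_iff]

lemma MemLp.comp_boxSection {E : Type*} [NormedAddCommGroup E] {X : Fin d → ℝ}
    (hX : ∀ i, 0 < X i) {G : EuclideanSpace ℝ (Fin d) → E} {p : ℝ≥0∞}
    (hG : MemLp G p (boxMeasure X)) : MemLp (fun y => G (boxSection X y)) p volume := by
  have h : Measure.map (boxSection X) volume =
      (ENNReal.ofReal (boxVolume X))⁻¹ • boxMeasure X := by
    rw [boxMeasure_eq_map hX, smul_smul, ENNReal.inv_mul_cancel, one_smul]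
    · simpa using boxVolume_pos hX
    · exact ENNReal.ofReal_ne_top
  have h' : MemLp G p (Measure.map (boxSection X) volume) := by
    rw [h]
    exact hG.smul_measure (ENNReal.inv_ne_top.2 (by simpa using boxVolume_pos hX))
  exact (measurableEmbedding_boxSection hX).memLp_map_measure_iff.1 h'

/-! ### The classical maximum principle for smooth periodic functions. -/

lemma iteratedFDeriv_two_eq_deriv_deriv {E F : Type*} [NormedAddCommGroup E] [NormedSpace ℝ E]
    [NormedAddCommGroup F] [NormedSpace ℝ F] {g : E → F} (hg : ContDiff ℝ 2 g) (x v : E) :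
    iteratedFDeriv ℝ 2 g x ![v, v] = deriv (deriv fun t : ℝ => g (x + t • v)) 0 := by
  have hl : ∀ t : ℝ, HasDerivAt (fun t : ℝ => x + t • v) v t := fun t => by
    simpa using ((hasDerivAt_id t).smul_const v).const_add x
  have h1 : (deriv fun t : ℝ => g (x + t • v)) = fun t => fderiv ℝ g (x + t • v) v := by
    ext t
    exact ((hg.differentiable (by norm_num) _).hasFDerivAt.comp_hasDerivAt t (hl t)).deriv
  have hg' : Differentiable ℝ (fderiv ℝ g) :=
    (hg.fderiv_right (m := 1) (by norm_num)).differentiable (by norm_num)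
  have h2 : HasDerivAt (fun t : ℝ => fderiv ℝ g (x + t • v)) (fderiv ℝ (fderiv ℝ g) x v) 0 := by
    have h3 : HasFDerivAt (fderiv ℝ g) (fderiv ℝ (fderiv ℝ g) x) (x + (0 : ℝ) • v) := by
      rw [zero_smul, add_zero]
      exact (hg' x).hasFDerivAt
    exact h3.comp_hasDerivAt (0 : ℝ) (hl 0)
  have h4 : HasDerivAt (fun t : ℝ => fderiv ℝ g (x + t • v) v)
      (fderiv ℝ (fderiv ℝ g) x v v) 0 :=
    (ContinuousLinearMap.apply ℝ F v).hasFDerivAt.comp_hasDerivAt (0 : ℝ) h2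
  rw [h1, iteratedFDeriv_two_apply, h4.deriv]
  rfl

lemma laplacian_eq_sum_deriv_deriv {F : Type*} [NormedAddCommGroup F] [NormedSpace ℝ F]
    {g : EuclideanSpace ℝ (Fin d) → F} (hg : ContDiff ℝ 2 g) (x : EuclideanSpace ℝ (Fin d)) :
    Laplacian.laplacian g x =
      ∑ i, deriv (deriv fun t : ℝ => g (x + t • EuclideanSpace.single i (1 : ℝ))) 0 := by
  rw [InnerProductSpace.laplacian_eq_iteratedFDeriv_orthonormalBasis g
    (EuclideanSpace.basisFun (Fin d) ℝ)]
  simp only [EuclideanSpace.basisFun_apply, iteratedFDeriv_two_eq_deriv_deriv hg]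

/-- A negative second derivative would make the point a local maximum too, hence `g` locally
constant, with second derivative zero. -/
lemma IsLocalMin.deriv_deriv_nonneg {g : ℝ → ℝ} {x : ℝ} (h : IsLocalMin g x)
    (hc : ContinuousAt g x) : 0 ≤ deriv (deriv g) x := by
  by_contra! hneg
  have hmax := isLocalMax_of_deriv_deriv_neg hneg h.deriv_eq_zero hc
  have hconst : g =ᶠ[nhds x] fun _ => g x := by
    filter_upwards [h, hmax] with y h1 h2 using le_antisymm h2 h1
  rw [hconst.deriv.deriv_eq] at hneg
  simp at hneg

lemma laplacian_nonneg_of_forall_le {η : EuclideanSpace ℝ (Fin d) → ℝ} (hη : ContDiff ℝ 2 η)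
    {x : EuclideanSpace ℝ (Fin d)} (hx : ∀ y, η x ≤ η y) : 0 ≤ Laplacian.laplacian η x := by
  rw [laplacian_eq_sum_deriv_deriv hη]
  refine Finset.sum_nonneg fun i _ => IsLocalMin.deriv_deriv_nonneg ?_ ?_
  · exact Filter.Eventually.of_forall fun t => by simpa using hx _
  · exact (hη.continuous.comp (by fun_prop)).continuousAt

/-- Every value of a periodic function is taken in the box. -/
lemma IsPeriodic.exists_mem_box {X : Fin d → ℝ} (hX : ∀ i, 0 < X i)
    {E : Type*} {η : EuclideanSpace ℝ (Fin d) → E}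
    (hp : ∀ i, Function.Periodic η (EuclideanSpace.single i (2 * X i)))
    (x : EuclideanSpace ℝ (Fin d)) : ∃ y ∈ box X, η y = η x := by
  classical
  -- The coordinates are moved into the box one at a time; a shift in direction `j` leaves the
  -- others alone.
  have key : ∀ s : Finset (Fin d), ∃ y : EuclideanSpace ℝ (Fin d),
      (∀ i ∈ s, y i ∈ Icc (-X i) (X i)) ∧ η y = η x := by
    intro s
    induction s using Finset.induction_on with
    | empty => exact ⟨x, by simp, rfl⟩
    | insert j s hj ih =>
      obtain ⟨y, hy, he⟩ := ih
      have h2 : 0 < 2 * X j := by have := hX j; positivity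
      refine ⟨y - toIcoDiv h2 (-X j) (y j) • EuclideanSpace.single j (2 * X j), ?_, ?_⟩
      · intro i hi
        rcases Finset.mem_insert.1 hi with rfl | hi
        · have := sub_toIcoDiv_zsmul_mem_Ico h2 (-X i) (y i)
          simp only [PiLp.sub_apply, PiLp.smul_apply, PiLp.single_apply, if_true]
          exact ⟨this.1, by have := this.2; simp only [zsmul_eq_mul] at *; linarith⟩
        · have hij : i ≠ j := fun h => hj (h ▸ hi)
          simpa [hij] using hy i hi
      · rw [(hp j).sub_zsmul_eq, he]
  obtain ⟨y, hy, he⟩ := key Finset.univ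
  exact ⟨y, fun i => hy i (Finset.mem_univ i), he⟩

lemma isCompact_box (X : Fin d → ℝ) : IsCompact (box X) := by
  have h : IsCompact ((EuclideanSpace.equiv (Fin d) ℝ).symm '' Icc (-X) X) :=
    isCompact_Icc.image (EuclideanSpace.equiv (Fin d) ℝ).symm.continuous
  convert h
  ext x
  constructor
  · exact fun hx => ⟨x.ofLp, ⟨fun i => (hx i).1, fun i => (hx i).2⟩, rfl⟩
  · rintro ⟨z, hz, rfl⟩ i
    exact ⟨hz.1 i, hz.2 i⟩

/-- The maximum principle for `c - a Δ` on smooth periodic functions. -/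
lemma nonneg_of_sub_laplacian_nonneg {X : Fin d → ℝ} (hX : ∀ i, 0 < X i)
    {η : EuclideanSpace ℝ (Fin d) → ℝ} (hη : ContDiff ℝ 2 η) (hp : IsPeriodic X η) {c a : ℝ}
    (hc : 0 < c) (ha : 0 ≤ a) (h : ∀ x, 0 ≤ c * η x - a * Laplacian.laplacian η x)
    (x : EuclideanSpace ℝ (Fin d)) : 0 ≤ η x := by
  have hne : (box X).Nonempty := ⟨0, fun i => by have := (hX i).le; simpa using this⟩
  obtain ⟨z, -, hz⟩ := (isCompact_box X).exists_isMinOn hne hη.continuous.continuousOn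
  have hmin : ∀ y, η z ≤ η y := fun y => by
    obtain ⟨w, hw, he⟩ := IsPeriodic.exists_mem_box hX hp y
    exact he ▸ hz hw
  have h1 := laplacian_nonneg_of_forall_le hη hmin
  have h2 : 0 ≤ c * η z := by have := h z; have := mul_nonneg ha h1; linarith
  exact (nonneg_of_mul_nonneg_right h2 hc).trans (hmin x)

/-! ### Characters, eigenvalues and the resolvent on trigonometric polynomials. -/

/-- The character of the periodic box with index `k`. -/
noncomputable def boxChar (X : Fin d → ℝ) (k : Fin d → ℤ) (x : EuclideanSpace ℝ (Fin d)) : ℂ :=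
  UnitAddTorus.mFourier k (torusProj X x)

/-- The eigenvalue of `-Δ` with index `k` on the periodic box. -/
noncomputable def boxEigenvalue (X : Fin d → ℝ) (k : Fin d → ℤ) : ℝ :=
  ∑ i, (Real.pi * k i / X i) ^ 2

lemma boxChar_eq_exp (X : Fin d → ℝ) (k : Fin d → ℤ) (x : EuclideanSpace ℝ (Fin d)) :
    boxChar X k x = Complex.exp (∑ i, Complex.I * (Real.pi * k i / X i) * x i) := by
  rw [boxChar, UnitAddTorus.mFourier, ContinuousMap.coe_mk, Complex.exp_sum]
  refine Finset.prod_congr rfl fun i _ => ?_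
  rw [torusProj, fourier_coe_apply]
  congr 1
  push_cast
  rw [div_one]
  ring

lemma contDiff_boxChar (X : Fin d → ℝ) (k : Fin d → ℤ) {n : WithTop ℕ∞} :
    ContDiff ℝ n (boxChar X k) := by
  rw [funext (boxChar_eq_exp X k)]
  refine ContDiff.cexp (ContDiff.sum fun i _ => contDiff_const.mul ?_)
  exact Complex.ofRealCLM.contDiff.comp (by fun_prop)

lemma periodic_comp_torusProj {X : Fin d → ℝ} (hX : ∀ i, 0 < X i) {E : Type*}
    (p : UnitAddTorus (Fin d) → E) (i : Fin d) :
    Function.Periodic (fun x => p (torusProj X x)) (EuclideanSpace.single i (2 * X i)) := by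
  intro x
  show p _ = p _
  congr 1
  ext j
  simp only [torusProj, PiLp.add_apply, PiLp.single_apply]
  have h : (2 * X j) ≠ 0 := by have := hX j; positivity
  split_ifs with hj
  · subst hj
    rw [add_div, div_self h, AddCircle.coe_add_period]
  · rw [add_zero]

lemma laplacian_boxChar (X : Fin d → ℝ) (k : Fin d → ℤ) (x : EuclideanSpace ℝ (Fin d)) :
    Laplacian.laplacian (boxChar X k) x = -(boxEigenvalue X k : ℂ) * boxChar X k x := by
  rw [laplacian_eq_sum_deriv_deriv (contDiff_boxChar X k)]
  have h1 : ∀ i, deriv (deriv fun t : ℝ =>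
      boxChar X k (x + t • EuclideanSpace.single i (1 : ℝ))) 0 =
      -((Real.pi * k i / X i) ^ 2 : ℝ) * boxChar X k x := by
    intro i
    set c : ℂ := Complex.I * (Real.pi * k i / X i) with hc
    have e1 : (fun t : ℝ => boxChar X k (x + t • EuclideanSpace.single i (1 : ℝ))) =
        fun t : ℝ => boxChar X k x * Complex.exp (c * t) := by
      ext t
      rw [boxChar_eq_exp, boxChar_eq_exp, ← Complex.exp_add]
      congr 1
      simp only [PiLp.add_apply, PiLp.smul_apply, PiLp.single_apply, smul_eq_mul, mul_ite, mul_one,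
        mul_zero, Complex.ofReal_add, mul_add, Finset.sum_add_distrib]
      congr 1
      rw [Finset.sum_eq_single i (fun j _ hj => by simp [hj]) (by simp)]
      simp [hc]
    have e2 : ∀ (b : ℂ) (t : ℝ), HasDerivAt (fun t : ℝ => b * Complex.exp (c * t))
        (b * c * Complex.exp (c * t)) t := by
      intro b t
      have h := (((hasDerivAt_id t).ofReal_comp.const_mul c).cexp).const_mul b
      refine h.congr_deriv ?_
      simp only [id, Complex.ofReal_one]
      ring
    have e3 : (deriv fun t : ℝ => boxChar X k x * Complex.exp (c * t)) =
        fun t : ℝ => boxChar X k x * c * Complex.exp (c * t) := funext fun t => (e2 _ t).deriv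
    rw [e1, e3, (e2 _ 0).deriv]
    have hI : c * c = -((Real.pi * k i / X i) ^ 2 : ℝ) := by
      rw [hc]; push_cast; linear_combination ((Real.pi * k i / X i : ℂ) ^ 2) * Complex.I_sq
    rw [mul_assoc (boxChar X k x), hI]
    simp [mul_comm]
  simp_rw [h1]
  rw [← Finset.sum_mul, boxEigenvalue]
  push_cast
  rw [Finset.sum_neg_distrib]

lemma two_le_coe_top : (2 : WithTop ℕ∞) ≤ ((⊤ : ℕ∞) : WithTop ℕ∞) :=
  WithTop.coe_le_coe.2 (le_top (a := (2 : ℕ∞)))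

/-- Cauchy-Schwarz for the inner product of `L²`. -/
lemma abs_integral_mul_le {α : Type*} [MeasurableSpace α] {μ : Measure α} {f g : α → ℝ}
    (hf : MemLp f 2 μ) (hg : MemLp g 2 μ) :
    |∫ x, f x * g x ∂μ| ≤ (eLpNorm f 2 μ).toReal * (eLpNorm g 2 μ).toReal := by
  have h := norm_inner_le_norm (𝕜 := ℝ) (hf.toLp f) (hg.toLp g)
  rw [L2.inner_def, Lp.norm_toLp, Lp.norm_toLp] at h
  convert h using 1
  rw [Real.norm_eq_abs]
  congr 1
  refine integral_congr_ae ?_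
  filter_upwards [hf.coeFn_toLp, hg.coeFn_toLp] with x h1 h2
  rw [h1, h2]
  simp [mul_comm]

lemma Continuous.memLp_boxMeasure {E : Type*} [NormedAddCommGroup E]
    {X : Fin d → ℝ} {η : EuclideanSpace ℝ (Fin d) → E} (hη : Continuous η) (p : ℝ≥0∞) :
    MemLp η p (boxMeasure X) := by
  have hm : MeasurableSet (box X) := (isCompact_box X).isClosed.measurableSet
  obtain ⟨C, hC⟩ := (isCompact_box X).exists_bound_of_continuousOn hη.continuousOn
  refine MemLp.of_bound ?_ C ((ae_restrict_iff' hm).2 (Filter.Eventually.of_forall hC))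
  exact hη.continuousOn.aestronglyMeasurable_of_isCompact (isCompact_box X) hm

lemma Continuous.integrable_boxMeasure {E : Type*} [NormedAddCommGroup E]
    {X : Fin d → ℝ} {η : EuclideanSpace ℝ (Fin d) → E} (hη : Continuous η) :
    Integrable η (boxMeasure X) :=
  memLp_one_iff_integrable.1 (Continuous.memLp_boxMeasure hη 1)

lemma continuous_torusProj (X : Fin d → ℝ) : Continuous (torusProj X) :=
  continuous_pi fun i => (AddCircle.continuous_mk' (1 : ℝ)).comp (by fun_prop)

lemma integral_mFourier_of_ne_zero {k : Fin d → ℤ} (hk : k ≠ 0) :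
    ∫ y : UnitAddTorus (Fin d), UnitAddTorus.mFourier k y = 0 := by
  have h := (orthonormal_iff_ite.1 (UnitAddTorus.orthonormal_mFourier (d := Fin d))) 0 k
  rw [if_neg (Ne.symm hk), ContinuousMap.inner_toLp] at h
  simpa [UnitAddTorus.mFourier_zero] using h

lemma boxEigenvalue_nonneg (X : Fin d → ℝ) (k : Fin d → ℤ) : 0 ≤ boxEigenvalue X k :=
  Finset.sum_nonneg fun _ _ => sq_nonneg _

/-- One factor always vanishes: the eigenvalue for `k = 0`, the integral otherwise. This says that
the Laplacian of a character has integral zero. -/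
lemma boxEigenvalue_mul_integral_boxChar {X : Fin d → ℝ} (hX : ∀ i, 0 < X i) (k : Fin d → ℤ) :
    (boxEigenvalue X k : ℂ) * ∫ x, boxChar X k x ∂(boxMeasure X) = 0 := by
  by_cases hk : k = 0
  · simp [hk, boxEigenvalue]
  · rw [integral_boxMeasure hX]
    simp_rw [boxChar, torusProj_boxSection hX]
    rw [integral_mFourier_of_ne_zero hk, smul_zero, mul_zero]

/-- Trigonometric polynomials are in the range of `c - a Δ` on smooth periodic functions. -/
lemma exists_resolvent_of_mem_span {X : Fin d → ℝ} (hX : ∀ i, 0 < X i) {c a : ℝ} (hc : 0 < c)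
    (ha : 0 ≤ a) {p : C(UnitAddTorus (Fin d), ℂ)}
    (hp : p ∈ Submodule.span ℂ (range (UnitAddTorus.mFourier (d := Fin d)))) :
    ∃ η : EuclideanSpace ℝ (Fin d) → ℂ, ContDiff ℝ (⊤ : ℕ∞) η ∧
      (∀ i, Function.Periodic η (EuclideanSpace.single i (2 * X i))) ∧
      (∀ x, c * η x - a * Laplacian.laplacian η x = p (torusProj X x)) ∧
      c * ∫ x, η x ∂(boxMeasure X) = ∫ x, p (torusProj X x) ∂(boxMeasure X) := by
  have hci : ∀ q : C(UnitAddTorus (Fin d), ℂ),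
      Integrable (fun x => q (torusProj X x)) (boxMeasure X) := fun q =>
    Continuous.integrable_boxMeasure (q.continuous.comp (continuous_torusProj X))
  induction hp using Submodule.span_induction with
  | mem p hp =>
    obtain ⟨k, rfl⟩ := hp
    -- On a character `c - aΔ` is multiplication by this number; `c > 0` keeps it nonzero also at `k
    -- = 0`.
    have hne : (c + a * boxEigenvalue X k : ℂ) ≠ 0 := by
      have := boxEigenvalue_nonneg X k
      have h : c + a * boxEigenvalue X k ≠ 0 := by positivity
      exact_mod_cast h
    refine ⟨(c + a * boxEigenvalue X k : ℂ)⁻¹ • boxChar X k, contDiff_const.smul (contDiff_boxChar X k),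
      fun i x => ?_, fun x => ?_, ?_⟩
    · simp only [Pi.smul_apply, boxChar]
      exact congrArg _ (periodic_comp_torusProj hX (UnitAddTorus.mFourier k) i x)
    · rw [InnerProductSpace.laplacian_smul _ (contDiff_boxChar X k).contDiffAt, laplacian_boxChar,
        Pi.smul_apply, smul_eq_mul, smul_eq_mul]
      change _ = boxChar X k x
      field_simp
      ring
    · have h0 := boxEigenvalue_mul_integral_boxChar hX k
      simp only [Pi.smul_apply]
      rw [integral_smul, smul_eq_mul]
      change _ = ∫ x, boxChar X k x ∂(boxMeasure X)
      field_simp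
      linear_combination (-(a : ℂ)) * h0
  | zero => exact ⟨0, contDiff_const, fun i x => rfl, fun x => by
      have h : Laplacian.laplacian (0 : EuclideanSpace ℝ (Fin d) → ℂ) = 0 :=
        InnerProductSpace.laplacian_const
      simp [h], by simp⟩
  | add p q _ _ hp hq =>
    obtain ⟨η, h1, h2, h3, h4⟩ := hp
    obtain ⟨ζ, g1, g2, g3, g4⟩ := hq
    refine ⟨η + ζ, h1.add g1, fun i => (h2 i).add (g2 i), fun x => ?_, ?_⟩
    · rw [((h1.of_le two_le_coe_top).contDiffAt).laplacian_add
        ((g1.of_le two_le_coe_top).contDiffAt), Pi.add_apply, ContinuousMap.add_apply, ← h3,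
        ← g3]
      ring
    · simp only [Pi.add_apply, ContinuousMap.add_apply]
      rw [integral_add (Continuous.integrable_boxMeasure h1.continuous)
        (Continuous.integrable_boxMeasure g1.continuous), integral_add (hci p) (hci q), ← h4, ← g4]
      ring
  | smul b p _ hp =>
    obtain ⟨η, h1, h2, h3, h4⟩ := hp
    refine ⟨b • η, h1.const_smul b, fun i x => ?_, fun x => ?_, ?_⟩
    · simp only [Pi.smul_apply, h2 i x]
    · rw [InnerProductSpace.laplacian_smul _ ((h1.of_le two_le_coe_top).contDiffAt),
        Pi.smul_apply, ContinuousMap.smul_apply, ← h3]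
      simp only [smul_eq_mul]
      ring
    · simp only [Pi.smul_apply, ContinuousMap.smul_apply]
      rw [integral_smul, integral_smul, ← h4]
      simp only [smul_eq_mul]
      ring

/-! ### The weak maximum principle, by duality. -/

/-- An `L²` function on the torus whose integrals against nonnegative trigonometric polynomials are
nonnegative is nonnegative almost everywhere. -/
lemma ae_nonneg_of_forall_trigPolynomial {Φ : UnitAddTorus (Fin d) → ℝ} (hΦ : MemLp Φ 2 volume)
    (h : ∀ p ∈ Submodule.span ℂ (range (UnitAddTorus.mFourier (d := Fin d))),
      (∀ y, 0 ≤ (p y).re) → 0 ≤ ∫ y, Φ y * (p y).re) : ∀ᵐ y, 0 ≤ Φ y := by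
  have hint : Integrable Φ := hΦ.integrable (by norm_num)
  have hcont : ∀ g : C(UnitAddTorus (Fin d), ℝ), Integrable fun y => Φ y * g y := fun g =>
    hint.mul_bdd (c := ‖g‖) g.continuous.aestronglyMeasurable
      (Filter.Eventually.of_forall fun y => g.norm_coe_le_norm y)
  have h1 : ∀ g : C(UnitAddTorus (Fin d), ℝ), (∀ y, 0 ≤ g y) → 0 ≤ ∫ y, Φ y * g y := by
    intro g hg
    set I := ∫ y, ‖Φ y‖
    have hI : 0 ≤ I := integral_nonneg fun _ => norm_nonneg _
    refine le_of_forall_pos_le_add fun δ hδ => ?_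
    set δ' := δ / (2 * (I + 1))
    have hδ' : 0 < δ' := by positivity
    let gc : C(UnitAddTorus (Fin d), ℂ) := ⟨fun y => (g y : ℂ), by fun_prop⟩
    have hmem : gc ∈ (Submodule.span ℂ
        (range (UnitAddTorus.mFourier (d := Fin d)))).topologicalClosure := by
      rw [UnitAddTorus.span_mFourier_closure_eq_top]; trivial
    obtain ⟨p, hp, hgp⟩ := Metric.mem_closure_iff.1 hmem δ' hδ'
    have hpg : ∀ y, |(p y).re - g y| ≤ δ' := fun y => by
      have e : (p y).re - g y = (p y - gc y).re := by simp [gc]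
      rw [e]
      refine (Complex.abs_re_le_norm _).trans ?_
      rw [dist_comm, dist_eq_norm] at hgp
      exact ((p - gc).norm_coe_le_norm y).trans hgp.le
    have h0 : (1 : C(UnitAddTorus (Fin d), ℂ)) ∈
        Submodule.span ℂ (range (UnitAddTorus.mFourier (d := Fin d))) :=
      Submodule.subset_span ⟨0, UnitAddTorus.mFourier_zero⟩
    -- The real part of `p` is only within `δ'` of `g ≥ 0`; adding `δ'` restores nonnegativity at
    -- the price of an error `2δ'`.
    have h2 := h (p + (δ' : ℂ) • 1) (Submodule.add_mem _ hp (Submodule.smul_mem _ _ h0)) fun y => by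
      have := (abs_le.1 (hpg y)).1
      have := hg y
      simp
      linarith
    let q : C(UnitAddTorus (Fin d), ℝ) := ⟨fun y => ((p + (δ' : ℂ) • 1 : C(_, ℂ)) y).re, by fun_prop⟩
    have h3 : (∫ y, Φ y * q y) - ∫ y, Φ y * g y ≤ δ := by
      rw [← integral_sub (hcont q) (hcont g)]
      calc ∫ y, (Φ y * q y - Φ y * g y) ≤ ∫ y, ‖Φ y‖ * (2 * δ') := by
            refine integral_mono ((hcont q).sub (hcont g)) (hint.norm.mul_const _) fun y => ?_
            have e : Φ y * q y - Φ y * g y = Φ y * ((p y).re - g y + δ') := by simp [q]; ring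
            refine (le_abs_self _).trans ?_
            dsimp only
            rw [e, abs_mul, Real.norm_eq_abs]
            refine mul_le_mul_of_nonneg_left ?_ (abs_nonneg _)
            have := abs_le.1 (hpg y)
            rw [abs_le]; constructor <;> linarith
        _ = I * (2 * δ') := integral_mul_const _ _
        _ ≤ δ := by
            have : (I + 1) * (2 * δ') = δ := by simp only [δ']; field_simp
            nlinarith
    have h4 : 0 ≤ ∫ y, Φ y * q y := h2
    linarith
  -- The ideal test function is the negative part of `Φ`, since it gives `-∫ Ψ²`. It need not be
  -- continuous, so it is approximated in `L²` by a continuous function, whose positive part is at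
  -- least as close.
  set Ψ : UnitAddTorus (Fin d) → ℝ := fun y => max (-Φ y) 0 with hΨd
  have hΨ : MemLp Ψ 2 volume := hΦ.neg.pos_part
  have hΨ2 : Integrable fun y => Ψ y ^ 2 := hΨ.integrable_sq
  have hΦΨ : ∀ y, Φ y * Ψ y = -Ψ y ^ 2 := fun y => by
    rcases le_total (-Φ y) 0 with hy | hy
    · simp [Ψ, max_eq_right hy]
    · simp [Ψ, max_eq_left hy]; ring
  have hle : ∫ y, Ψ y ^ 2 ≤ 0 := by
    refine le_of_forall_pos_le_add fun δ hδ => ?_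
    have hN := ENNReal.toReal_nonneg (a := eLpNorm Φ 2 volume)
    set N := (eLpNorm Φ 2 volume).toReal
    set δ' := δ / (N + 1)
    have hδ' : 0 < δ' := by positivity
    obtain ⟨g, hg, hgm⟩ := hΨ.exists_boundedContinuous_eLpNorm_sub_le (by norm_num)
      (ε := ENNReal.ofReal δ') (by simpa using hδ')
    let g' : C(UnitAddTorus (Fin d), ℝ) := ⟨fun y => max (g y) 0, by fun_prop⟩
    have h5 := h1 g' fun y => le_max_right _ _
    have hg'm : MemLp g' 2 volume := hgm.pos_part
    have h6 : eLpNorm (fun y => Ψ y - g' y) 2 volume ≤ ENNReal.ofReal δ' := by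
      refine (eLpNorm_mono fun y => ?_).trans hg
      simp only [Pi.sub_apply, Real.norm_eq_abs]
      have : max (Ψ y) 0 = Ψ y := max_eq_left (le_max_right _ _)
      have h' := abs_max_sub_max_le_abs (Ψ y) (g y) 0
      rwa [this] at h'
    have h7 : |∫ y, Φ y * (Ψ y - g' y)| ≤ N * δ' := by
      refine (abs_integral_mul_le hΦ (hΨ.sub hg'm)).trans (mul_le_mul_of_nonneg_left ?_ hN)
      exact ENNReal.toReal_le_of_le_ofReal hδ'.le h6
    have hi1 : Integrable fun y => Φ y * Ψ y := by simpa [hΦΨ] using hΨ2.neg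
    have h8 : ∫ y, Φ y * (Ψ y - g' y) = -(∫ y, Ψ y ^ 2) - ∫ y, Φ y * g' y := by
      simp_rw [mul_sub]
      rw [integral_sub hi1 (hcont g')]
      simp_rw [hΦΨ]
      rw [integral_neg]
    have h9 : N * δ' ≤ δ := by
      have : (N + 1) * δ' = δ := by simp only [δ']; field_simp
      nlinarith
    have := (abs_le.1 h7).1
    linarith
  have hz : (fun y => Ψ y ^ 2) =ᵐ[volume] 0 := by
    rw [← integral_eq_zero_iff_of_nonneg (fun y => sq_nonneg _) hΨ2]
    exact le_antisymm hle (integral_nonneg fun y => sq_nonneg _)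
  filter_upwards [hz] with y hy
  have hy' : Ψ y = 0 := by simpa using hy
  have := le_max_left (-Φ y) 0
  simp only [hΨd] at hy'
  linarith

lemma laplacian_re {η : EuclideanSpace ℝ (Fin d) → ℂ} (hη : ContDiff ℝ 2 η)
    (x : EuclideanSpace ℝ (Fin d)) :
    Laplacian.laplacian (fun x => (η x).re) x = (Laplacian.laplacian η x).re :=
  hη.contDiffAt.laplacian_CLM_comp_left (l := Complex.reCLM)

lemma laplacian_im {η : EuclideanSpace ℝ (Fin d) → ℂ} (hη : ContDiff ℝ 2 η)
    (x : EuclideanSpace ℝ (Fin d)) :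
    Laplacian.laplacian (fun x => (η x).im) x = (Laplacian.laplacian η x).im :=
  hη.contDiffAt.laplacian_CLM_comp_left (l := Complex.imCLM)

/-- The weak maximum principle for `c - a Δ` on the periodic box. -/
lemma ae_le_of_mul_le_sub_laplacian {X : Fin d → ℝ} (hX : ∀ i, 0 < X i) {c a m : ℝ} (hc : 0 < c)
    (ha : 0 ≤ a) {φ L : EuclideanSpace ℝ (Fin d) → ℝ} (hφ : MemLp φ 2 (boxMeasure X))
    (hL : MemLp L 2 (boxMeasure X)) (hw : HasWeakLaplacian X φ L)
    (h : ∀ᵐ x ∂(boxMeasure X), c * m ≤ c * φ x - a * L x) : ∀ᵐ x ∂(boxMeasure X), m ≤ φ x := by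
  rw [ae_boxMeasure_iff hX]
  have hΦ : MemLp (fun y => φ (boxSection X y) - m) 2 (volume : Measure (UnitAddTorus (Fin d))) :=
    (MemLp.comp_boxSection hX hφ).sub (memLp_const m)
  suffices h' : ∀ᵐ y : UnitAddTorus (Fin d), 0 ≤ φ (boxSection X y) - m by
    filter_upwards [h'] with y hy using sub_nonneg.1 hy
  refine ae_nonneg_of_forall_trigPolynomial hΦ fun p hp hpos => ?_
  obtain ⟨η, h1, h2, h3, h4⟩ := exists_resolvent_of_mem_span hX hc ha hp
  set ζ : EuclideanSpace ℝ (Fin d) → ℝ := fun x => (η x).re with hζ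
  have hζs : ContDiff ℝ (⊤ : ℕ∞) ζ := Complex.reCLM.contDiff.comp h1
  have hζp : IsPeriodic X ζ := fun i x => congrArg Complex.re (h2 i x)
  have hζe : ∀ x, c * ζ x - a * Laplacian.laplacian ζ x = (p (torusProj X x)).re := fun x => by
    rw [hζ, laplacian_re (h1.of_le two_le_coe_top), ← h3]
    simp
  have hpc : Continuous fun x => p (torusProj X x) := p.continuous.comp (continuous_torusProj X)
  have hζ0 : ∀ x, 0 ≤ ζ x :=
    nonneg_of_sub_laplacian_nonneg hX (hζs.of_le two_le_coe_top) hζp hc ha fun x => by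
      rw [hζe]; exact hpos _
  have hζint : c * ∫ x, ζ x ∂(boxMeasure X) = ∫ x, (p (torusProj X x)).re ∂(boxMeasure X) := by
    have e1 := integral_re (𝕜 := ℂ) (Continuous.integrable_boxMeasure (X := X) h1.continuous)
    have e2 := integral_re (𝕜 := ℂ) (Continuous.integrable_boxMeasure (X := X) hpc)
    simp only [RCLike.re_eq_complex_re] at e1 e2
    rw [e1, e2, ← h4]
    simp
  have hζ2 : MemLp ζ 2 (boxMeasure X) := Continuous.memLp_boxMeasure hζs.continuous 2
  have hP2 : MemLp (fun x => (p (torusProj X x)).re) 2 (boxMeasure X) :=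
    Continuous.memLp_boxMeasure (Complex.continuous_re.comp hpc) 2
  have hφζ : Integrable (fun x => φ x * ζ x) (boxMeasure X) := hφ.integrable_mul hζ2
  have hLζ : Integrable (fun x => L x * ζ x) (boxMeasure X) := hL.integrable_mul hζ2
  have hφP : Integrable (fun x => φ x * (p (torusProj X x)).re) (boxMeasure X) :=
    hφ.integrable_mul hP2
  have hPi : Integrable (fun x => (p (torusProj X x)).re) (boxMeasure X) :=
    hP2.integrable (by norm_num)
  have hζi : Integrable ζ (boxMeasure X) := hζ2.integrable (by norm_num)
  -- The weak equation moves `c - aΔ` from the test function `ζ` to `φ`.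
  have e1 : ∫ x, φ x * (p (torusProj X x)).re ∂(boxMeasure X) =
      ∫ x, (c * φ x - a * L x) * ζ x ∂(boxMeasure X) := by
    have e2 : a * ∫ x, L x * ζ x ∂(boxMeasure X) =
        c * ∫ x, φ x * ζ x ∂(boxMeasure X) -
          ∫ x, φ x * (p (torusProj X x)).re ∂(boxMeasure X) := by
      rw [← hw ζ hζs hζp, ← integral_const_mul, ← integral_const_mul,
        ← integral_sub (hφζ.const_mul c) hφP]
      congr 1
      ext x
      rw [← hζe]
      ring
    have e3 : ∀ x, (c * φ x - a * L x) * ζ x = c * (φ x * ζ x) - a * (L x * ζ x) := fun x => by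
      ring
    simp_rw [e3]
    rw [integral_sub (hφζ.const_mul c) (hLζ.const_mul a), integral_const_mul, integral_const_mul,
      e2]
    ring
  have e4 : ∫ x, c * m * ζ x ∂(boxMeasure X) ≤ ∫ x, (c * φ x - a * L x) * ζ x ∂(boxMeasure X) := by
    refine integral_mono_ae (hζi.const_mul _) ?_ ?_
    · refine ((hφζ.const_mul c).sub (hLζ.const_mul a)).congr (Filter.Eventually.of_forall fun x => ?_)
      simp only [Pi.sub_apply]
      ring
    · filter_upwards [h] with x hx using mul_le_mul_of_nonneg_right hx (hζ0 x)
  have e5 : ∫ x, (φ x - m) * (p (torusProj X x)).re ∂(boxMeasure X) =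
      boxVolume X * ∫ y, (φ (boxSection X y) - m) * (p y).re := by
    rw [integral_boxMeasure hX]
    simp_rw [torusProj_boxSection hX]
    rfl
  have e6 : 0 ≤ ∫ x, (φ x - m) * (p (torusProj X x)).re ∂(boxMeasure X) := by
    simp_rw [sub_mul]
    rw [integral_sub hφP (hPi.const_mul m), integral_const_mul, ← hζint, e1]
    rw [integral_const_mul] at e4
    linarith
  rw [e5] at e6
  exact nonneg_of_mul_nonneg_right e6 (boxVolume_pos hX)

lemma HasWeakLaplacian.neg {X : Fin d → ℝ} {u g : EuclideanSpace ℝ (Fin d) → ℝ}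
    (h : HasWeakLaplacian X u g) : HasWeakLaplacian X (fun x => -u x) fun x => -g x := by
  intro η h1 h2
  simp only [neg_mul, integral_neg, h η h1 h2]

lemma ae_ge_of_sub_laplacian_le_mul {X : Fin d → ℝ} (hX : ∀ i, 0 < X i) {c a m : ℝ} (hc : 0 < c)
    (ha : 0 ≤ a) {φ L : EuclideanSpace ℝ (Fin d) → ℝ} (hφ : MemLp φ 2 (boxMeasure X))
    (hL : MemLp L 2 (boxMeasure X)) (hw : HasWeakLaplacian X φ L)
    (h : ∀ᵐ x ∂(boxMeasure X), c * φ x - a * L x ≤ c * m) : ∀ᵐ x ∂(boxMeasure X), φ x ≤ m := by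
  have h' := ae_le_of_mul_le_sub_laplacian hX (m := -m) hc ha hφ.neg hL.neg hw.neg (by
    filter_upwards [h] with x hx
    simp only [Pi.neg_apply]
    linarith)
  filter_upwards [h'] with x hx
  simp only [Pi.neg_apply] at hx
  linarith

/-! ### Boundedness of the inverse Laplacian on `L^∞`. -/

/-- The lattice of integer points has rank `d < 4`. This is where the dimension restriction enters.
-/
lemma summable_norm_inv_pow_four (hd : d ≤ 3) :
    Summable fun k : Fin d → ℤ => ‖(fun i => (k i : ℝ))‖⁻¹ ^ 4 := by
  let b := Pi.basisFun ℝ (Fin d)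
  let Λ : Submodule ℤ (Fin d → ℝ) := Submodule.span ℤ (range b)
  have hrank : Module.finrank ℤ Λ < 4 := by
    rw [ZLattice.rank ℝ Λ, Module.finrank_fin_fun]
    omega
  have hmem : ∀ k : Fin d → ℤ, (fun i => (k i : ℝ)) ∈ Λ := fun k => by
    exact (b.mem_span_iff_repr_mem ℤ _).2 fun i => ⟨k i, by simp [b]⟩
  refine (ZLattice.summable_norm_pow_inv Λ 4 hrank).comp_injective
    (i := fun k : Fin d → ℤ => (⟨fun i => (k i : ℝ), hmem k⟩ : Λ)) fun k l hkl => ?_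
  ext i
  exact Int.cast_injective (α := ℝ) (congrFun (congrArg Subtype.val hkl) i)

lemma boxEigenvalue_pos {X : Fin d → ℝ} (hX : ∀ i, 0 < X i) {k : Fin d → ℤ} (hk : k ≠ 0) :
    0 < boxEigenvalue X k := by
  obtain ⟨i, hi⟩ := Function.ne_iff.1 hk
  refine Finset.sum_pos' (fun _ _ => sq_nonneg _) ⟨i, Finset.mem_univ i, ?_⟩
  have h : (k i : ℝ) ≠ 0 := Int.cast_ne_zero.2 hi
  have := (hX i).ne'
  positivity

lemma boxEigenvalue_neg (X : Fin d → ℝ) (k : Fin d → ℤ) :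
    boxEigenvalue X (-k) = boxEigenvalue X k := by
  refine Finset.sum_congr rfl fun i _ => ?_
  simp only [Pi.neg_apply, Int.cast_neg, mul_neg, neg_div, neg_sq]

/-- Eigenvalues grow at least like `‖k‖²`, which reduces the sum to `∑ ‖k‖⁻⁴`. The zero mode
contributes nothing because `0⁻¹ = 0`. -/
lemma summable_boxEigenvalue_inv_sq (hd : d ≤ 3) {X : Fin d → ℝ} (hX : ∀ i, 0 < X i) :
    Summable fun k : Fin d → ℤ => ((boxEigenvalue X k)⁻¹) ^ 2 := by
  set c : ℝ := ∑ i, (X i / Real.pi) ^ 2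
  have hc : 0 ≤ c := Finset.sum_nonneg fun _ _ => sq_nonneg _
  refine Summable.of_nonneg_of_le (fun _ => sq_nonneg _) (fun k => ?_)
    ((summable_norm_inv_pow_four hd).mul_left (c ^ 2))
  by_cases hk : k = 0
  · simp only [hk, boxEigenvalue]
    simp only [Pi.zero_apply, Int.cast_zero, mul_zero, zero_div, ne_eq, OfNat.ofNat_ne_zero,
      not_false_eq_true, zero_pow, Finset.sum_const_zero, inv_zero]
    positivity
  have hn : 0 < ‖(fun i => (k i : ℝ))‖ := by
    rw [norm_pos_iff]
    intro h
    exact hk (funext fun i => Int.cast_injective (α := ℝ) (by simpa using congrFun h i))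
  have hle : ‖(fun i => (k i : ℝ))‖ ^ 2 ≤ c * boxEigenvalue X k := by
    have h1 : ‖(fun i => (k i : ℝ))‖ ≤ √(c * boxEigenvalue X k) := by
      refine (pi_norm_le_iff_of_nonneg (Real.sqrt_nonneg _)).2 fun i => Real.le_sqrt_of_sq_le ?_
      have h2 : ‖(k i : ℝ)‖ ^ 2 = (X i / Real.pi) ^ 2 * (Real.pi * k i / X i) ^ 2 := by
        have := (hX i).ne'
        have := Real.pi_ne_zero
        rw [Real.norm_eq_abs, sq_abs]
        field_simp
      rw [h2]
      exact mul_le_mul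
        (Finset.single_le_sum (f := fun i => (X i / Real.pi) ^ 2) (fun _ _ => sq_nonneg _)
          (Finset.mem_univ i))
        (Finset.single_le_sum (f := fun i => (Real.pi * k i / X i) ^ 2) (fun _ _ => sq_nonneg _)
          (Finset.mem_univ i)) (sq_nonneg _) hc
    rw [← Real.sq_sqrt (mul_nonneg hc (boxEigenvalue_nonneg X k))]
    gcongr
  have hlam := boxEigenvalue_pos hX hk
  have h3 : (boxEigenvalue X k)⁻¹ ≤ c * ‖(fun i => (k i : ℝ))‖⁻¹ ^ 2 := by
    rw [inv_pow, ← div_eq_mul_inv, le_div_iff₀ (by positivity), inv_mul_le_iff₀ hlam]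
    linarith
  calc ((boxEigenvalue X k)⁻¹) ^ 2 ≤ (c * ‖(fun i => (k i : ℝ))‖⁻¹ ^ 2) ^ 2 := by gcongr
    _ = c ^ 2 * ‖(fun i => (k i : ℝ))‖⁻¹ ^ 4 := by ring

/-- The weak equation is tested with the real and imaginary parts of a character, as its test
functions are real. It yields the relation between Fourier coefficients. -/
lemma mul_integral_ofReal_mul_boxChar {X : Fin d → ℝ} (hX : ∀ i, 0 < X i)
    {u g : EuclideanSpace ℝ (Fin d) → ℝ} (hu : MemLp u 2 (boxMeasure X))
    (hg : MemLp g 2 (boxMeasure X)) (h : HasWeakLaplacian X u g) (k : Fin d → ℤ) :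
    -(boxEigenvalue X k : ℂ) * ∫ x, boxChar X k x * u x ∂(boxMeasure X) =
      ∫ x, boxChar X k x * g x ∂(boxMeasure X) := by
  have hs : ContDiff ℝ (⊤ : ℕ∞) (boxChar X k) := contDiff_boxChar X k
  have h2 : ContDiff ℝ 2 (boxChar X k) := contDiff_boxChar X k
  have hp := periodic_comp_torusProj hX (UnitAddTorus.mFourier k)
  have hre := h (fun x => (boxChar X k x).re) (Complex.reCLM.contDiff.comp hs)
    fun i x => congrArg Complex.re (hp i x)
  have him := h (fun x => (boxChar X k x).im) (Complex.imCLM.contDiff.comp hs)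
    fun i x => congrArg Complex.im (hp i x)
  simp only [laplacian_re h2, laplacian_im h2, laplacian_boxChar] at hre him
  have hint : ∀ {v : EuclideanSpace ℝ (Fin d) → ℝ}, MemLp v 2 (boxMeasure X) →
      Integrable (fun x => boxChar X k x * v x) (boxMeasure X) := fun hv =>
    (Continuous.memLp_boxMeasure hs.continuous 2).integrable_mul hv.ofReal
  have hr : ∀ {v : EuclideanSpace ℝ (Fin d) → ℝ}, MemLp v 2 (boxMeasure X) →
      (∫ x, boxChar X k x * v x ∂(boxMeasure X)).re =
        ∫ x, v x * (boxChar X k x).re ∂(boxMeasure X) := fun {v} hv => by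
    have e := integral_re (𝕜 := ℂ) (hint hv)
    simp only [RCLike.re_eq_complex_re] at e
    rw [← e]
    simp [mul_comm]
  have hi : ∀ {v : EuclideanSpace ℝ (Fin d) → ℝ}, MemLp v 2 (boxMeasure X) →
      (∫ x, boxChar X k x * v x ∂(boxMeasure X)).im =
        ∫ x, v x * (boxChar X k x).im ∂(boxMeasure X) := fun {v} hv => by
    have e := integral_im (𝕜 := ℂ) (hint hv)
    simp only [RCLike.im_eq_complex_im] at e
    rw [← e]
    simp [mul_comm]
  apply Complex.ext
  · rw [hr hg, ← hre, ← Complex.ofReal_neg, Complex.re_ofReal_mul, hr hu, ← integral_const_mul]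
    congr 1
    ext x
    rw [Complex.re_ofReal_mul]
    ring
  · rw [hi hg, ← him, ← Complex.ofReal_neg, Complex.im_ofReal_mul, hi hu, ← integral_const_mul]
    congr 1
    ext x
    rw [Complex.im_ofReal_mul]
    ring

/-- An `L²` function on the torus with absolutely summable Fourier coefficients is bounded. -/
lemma ae_norm_le_tsum_mFourierCoeff {U : UnitAddTorus (Fin d) → ℂ} (hU : MemLp U 2 volume)
    (hs : Summable fun k => ‖UnitAddTorus.mFourierCoeff U k‖) :
    ∀ᵐ y, ‖U y‖ ≤ ∑' k, ‖UnitAddTorus.mFourierCoeff U k‖ := by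
  have hn : ∀ k, ‖UnitAddTorus.mFourierCoeff U k • UnitAddTorus.mFourier k‖ =
      ‖UnitAddTorus.mFourierCoeff U k‖ := fun k => by
    rw [norm_smul, UnitAddTorus.mFourier_norm, mul_one]
  have hs' : Summable fun k => ‖UnitAddTorus.mFourierCoeff U k • UnitAddTorus.mFourier k‖ := by
    simpa only [hn] using hs
  set S : C(UnitAddTorus (Fin d), ℂ) :=
    ∑' k, UnitAddTorus.mFourierCoeff U k • UnitAddTorus.mFourier k
  have h1 : HasSum (fun k => UnitAddTorus.mFourierCoeff U k • UnitAddTorus.mFourierLp 2 k)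
      (ContinuousMap.toLp (E := ℂ) 2 volume ℂ S) := by
    simpa only [map_smul] using
      (ContinuousMap.toLp (E := ℂ) 2 (volume : Measure (UnitAddTorus (Fin d))) ℂ).hasSum
        hs'.of_norm.hasSum
  have hc : ∀ k, UnitAddTorus.mFourierCoeff (hU.toLp U) k = UnitAddTorus.mFourierCoeff U k :=
    fun k => integral_congr_ae (by filter_upwards [hU.coeFn_toLp] with y hy using by rw [hy])
  have h2 := UnitAddTorus.hasSum_mFourier_series_L2 (hU.toLp U)
  simp only [hc] at h2
  -- The uniform sum `S` and `U` have the same Fourier series in `L²`, so they agree almost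
  -- everywhere and the sup bound on `S` transfers.
  have h3 := h1.unique h2
  have h4 : ‖S‖ ≤ ∑' k, ‖UnitAddTorus.mFourierCoeff U k‖ := by
    simpa only [hn] using norm_tsum_le_tsum_norm hs'
  have h5 := ContinuousMap.coeFn_toLp (p := 2) (𝕜 := ℂ) volume S
  rw [h3] at h5
  filter_upwards [hU.coeFn_toLp, h5] with y e1 e2
  rw [← e1, e2]
  exact (S.norm_coe_le_norm y).trans h4

/-- The constant `√(∑ λ_k⁻²)`, which bounds `(-Δ)⁻¹` from `L²` of the torus to `L^∞`. -/
noncomputable def greenBound (X : Fin d → ℝ) : ℝ :=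
  √(∑' k : Fin d → ℤ, ((boxEigenvalue X k)⁻¹) ^ 2)

/-- The coefficients of `u` are those of the centred `g` divided by eigenvalues, so Cauchy-Schwarz
sums them absolutely. The factor 2 pays for subtracting the mean. -/
lemma IsInvNegLaplacian.ae_abs_le (hd : d ≤ 3) {X : Fin d → ℝ} (hX : ∀ i, 0 < X i)
    {g u : EuclideanSpace ℝ (Fin d) → ℝ} (h : IsInvNegLaplacian X g u) {K : ℝ}
    (hgm : AEStronglyMeasurable g (boxMeasure X)) (hg : ∀ᵐ x ∂(boxMeasure X), |g x| ≤ K) :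
    ∀ᵐ x ∂(boxMeasure X), |u x| ≤ 2 * greenBound X * K := by
  have hVpos := boxVolume_pos hX
  set b : ℝ := ⨍ y, g y ∂(boxMeasure X)
  have hgi : MemLp g ∞ (boxMeasure X) := memLp_top_of_bound hgm K hg
  have hne : boxMeasure X ≠ 0 := by
    intro h0
    have h1 := integral_boxMeasure hX (fun _ => (1 : ℝ))
    rw [h0] at h1
    simp at h1
    exact hVpos.ne' h1.symm
  have : NeZero (boxMeasure X) := ⟨hne⟩
  have hK : 0 ≤ K := by
    obtain ⟨x, hx⟩ := hg.exists
    exact (abs_nonneg _).trans hx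
  have hb : |b| ≤ K := by
    have h1 : ‖∫ y, g y ∂(boxMeasure X)‖ ≤ K * (boxMeasure X).real univ :=
      norm_integral_le_of_norm_le_const hg
    have hm : 0 < (boxMeasure X).real univ := by
      rw [measureReal_def]
      exact ENNReal.toReal_pos (by simpa using hne) (measure_ne_top _ _)
    rw [show b = _ from average_eq _ _, smul_eq_mul, abs_mul, abs_of_pos (inv_pos.2 hm),
      inv_mul_le_iff₀ hm, mul_comm]
    exact h1
  have hG2 : MemLp (fun x => -(g x - b)) 2 (boxMeasure X) :=
    ((hgi.mono_exponent le_top).sub (memLp_const b)).neg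
  have hrel := mul_integral_ofReal_mul_boxChar hX h.memLp hG2 h.eqn
  set U : UnitAddTorus (Fin d) → ℂ := fun y => (u (boxSection X y) : ℂ) with hUd
  set G : UnitAddTorus (Fin d) → ℂ := fun y => ((-(g (boxSection X y) - b) : ℝ) : ℂ) with hGd
  have hU : MemLp U 2 volume := (MemLp.comp_boxSection hX h.memLp).ofReal
  have hG : MemLp G 2 volume := (MemLp.comp_boxSection hX hG2).ofReal
  have htr : ∀ (v : EuclideanSpace ℝ (Fin d) → ℝ) (k : Fin d → ℤ),
      ∫ x, boxChar X (-k) x * v x ∂(boxMeasure X) =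
        boxVolume X * UnitAddTorus.mFourierCoeff (fun y => (v (boxSection X y) : ℂ)) k := by
    intro v k
    rw [integral_boxMeasure hX, UnitAddTorus.mFourierCoeff]
    simp_rw [boxChar, torusProj_boxSection hX]
    simp
  have hVc : (boxVolume X : ℂ) ≠ 0 := Complex.ofReal_ne_zero.2 hVpos.ne'
  have hcoef : ∀ k, -(boxEigenvalue X k : ℂ) * UnitAddTorus.mFourierCoeff U k =
      UnitAddTorus.mFourierCoeff G k := fun k => by
    have h1 := hrel (-k)
    rw [htr, htr, boxEigenvalue_neg] at h1
    exact mul_left_cancel₀ hVc (by linear_combination h1)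
  -- The equation says nothing about the zero mode; the mean-zero normalization removes it.
  have hU0 : UnitAddTorus.mFourierCoeff U 0 = 0 := by
    have h1 := htr u 0
    have h2 : ∀ x, boxChar X (-0) x = 1 := fun x => by
      rw [neg_zero, boxChar, UnitAddTorus.mFourier_zero]; rfl
    simp_rw [h2, one_mul] at h1
    rw [integral_complex_ofReal, h.mean_zero, Complex.ofReal_zero] at h1
    exact (mul_eq_zero.1 h1.symm).resolve_left hVc
  have hle : ∀ k, ‖UnitAddTorus.mFourierCoeff U k‖ ≤
      ‖UnitAddTorus.mFourierCoeff G k‖ * (boxEigenvalue X k)⁻¹ := fun k => by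
    by_cases hk : k = 0
    · rw [hk, hU0, norm_zero]
      exact mul_nonneg (norm_nonneg _) (inv_nonneg.2 (boxEigenvalue_nonneg X 0))
    · have hp := boxEigenvalue_pos hX hk
      rw [← hcoef, norm_mul, norm_neg, Complex.norm_real, Real.norm_of_nonneg hp.le]
      apply le_of_eq
      field_simp
  have hGK : ∀ᵐ y, ‖G y‖ ≤ 2 * K := by
    filter_upwards [(ae_boxMeasure_iff hX).1 hg] with y hy
    rw [hGd, Complex.norm_real, Real.norm_eq_abs, abs_neg]
    have := abs_sub (g (boxSection X y)) b
    linarith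
  have hpars : HasSum (fun k => ‖UnitAddTorus.mFourierCoeff G k‖ ^ 2) (∫ y, ‖G y‖ ^ 2) := by
    have h1 := UnitAddTorus.hasSum_sq_mFourierCoeff (hG.toLp G)
    have h2 : ∀ k, UnitAddTorus.mFourierCoeff (hG.toLp G) k = UnitAddTorus.mFourierCoeff G k :=
      fun k => integral_congr_ae (by filter_upwards [hG.coeFn_toLp] with y hy using by rw [hy])
    have h3 : ∫ y, ‖hG.toLp G y‖ ^ 2 = ∫ y, ‖G y‖ ^ 2 :=
      integral_congr_ae (by filter_upwards [hG.coeFn_toLp] with y hy using by rw [hy])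
    simpa only [h2, h3] using h1
  have hGn : ∑' k, ‖UnitAddTorus.mFourierCoeff G k‖ ^ 2 ≤ (2 * K) ^ 2 := by
    rw [hpars.tsum_eq]
    calc ∫ y, ‖G y‖ ^ 2 ≤ ∫ _ : UnitAddTorus (Fin d), (2 * K) ^ 2 := by
          refine integral_mono_ae hG.integrable_norm_pow' (integrable_const _) ?_
          filter_upwards [hGK] with y hy using by gcongr
      _ = (2 * K) ^ 2 := by simp
  have hCS := Real.summable_and_inner_le_Lp_mul_Lq_tsum_of_nonneg
    (f := fun k => ‖UnitAddTorus.mFourierCoeff G k‖) (g := fun k => (boxEigenvalue X k)⁻¹)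
    Real.HolderConjugate.two_two (fun k => norm_nonneg _)
    (fun k => inv_nonneg.2 (boxEigenvalue_nonneg X k))
    (by simpa only [Real.rpow_two] using hpars.summable)
    (by simpa only [Real.rpow_two] using summable_boxEigenvalue_inv_sq hd hX)
  simp only [Real.rpow_two, ← Real.sqrt_eq_rpow] at hCS
  have hs : Summable fun k => ‖UnitAddTorus.mFourierCoeff U k‖ :=
    Summable.of_nonneg_of_le (fun _ => norm_nonneg _) hle hCS.1
  have hfin : ∑' k, ‖UnitAddTorus.mFourierCoeff U k‖ ≤ 2 * greenBound X * K := by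
    refine (hs.tsum_le_tsum hle hCS.1).trans (hCS.2.trans ?_)
    have h1 : √(∑' k, ‖UnitAddTorus.mFourierCoeff G k‖ ^ 2) ≤ 2 * K :=
      Real.sqrt_le_iff.2 ⟨by positivity, hGn⟩
    calc _ ≤ 2 * K * greenBound X := mul_le_mul_of_nonneg_right h1 (Real.sqrt_nonneg _)
      _ = 2 * greenBound X * K := by ring
  rw [ae_boxMeasure_iff hX]
  filter_upwards [ae_norm_le_tsum_mFourierCoeff hU hs] with y hy
  have h1 : ‖U y‖ = |u (boxSection X y)| := by rw [hUd, Complex.norm_real, Real.norm_eq_abs]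
  rw [← h1]
  exact hy.trans hfin

/-- The norm of `(-Δ)⁻¹` is a bound for `(-Δ)⁻¹` on `L^∞`. -/
lemma ae_abs_invNegLaplacian_le (hd : d ≤ 3) {X : Fin d → ℝ} (hX : ∀ i, 0 < X i)
    {g : EuclideanSpace ℝ (Fin d) → ℝ} (hgp : IsPeriodic X g)
    (hgm : AEStronglyMeasurable g (boxMeasure X)) {K : ℝ} (hK : 0 ≤ K)
    (hg : ∀ᵐ x ∂(boxMeasure X), |g x| ≤ K) :
    ∀ᵐ x ∂(boxMeasure X), |invNegLaplacian X g x| ≤ invNegLaplacianNorm X * K := by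
  set S : Set ℝ := {C : ℝ | 0 ≤ C ∧ ∀ g : EuclideanSpace ℝ (Fin d) → ℝ,
    IsPeriodic X g → MemLp g ∞ (boxMeasure X) →
      eLpNorm (invNegLaplacian X g) ∞ (boxMeasure X) ≤
        ENNReal.ofReal C * eLpNorm g ∞ (boxMeasure X)} with hS
  -- Without an admissible constant the real infimum would be the junk value 0 and would bound
  -- nothing.
  have hne : S.Nonempty := by
    have hC : 0 ≤ 2 * greenBound X := mul_nonneg zero_le_two (Real.sqrt_nonneg _)
    refine ⟨2 * greenBound X, hC, fun g _ hg => ?_⟩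
    by_cases hex : ∃ u, IsInvNegLaplacian X g u
    · rw [invNegLaplacian, dif_pos hex]
      have h1 : ∀ᵐ x ∂(boxMeasure X), |g x| ≤ (eLpNorm g ∞ (boxMeasure X)).toReal := by
        rw [eLpNorm_exponent_top]
        filter_upwards [ae_le_eLpNormEssSup (f := g) (μ := boxMeasure X)] with x hx
        have := ENNReal.toReal_mono (by simpa using hg.eLpNorm_ne_top) hx
        simpa using this
      have h2 := hex.choose_spec.ae_abs_le hd hX hg.1 h1
      rw [eLpNorm_exponent_top]
      refine (eLpNormEssSup_le_of_ae_bound h2).trans ?_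
      rw [ENNReal.ofReal_mul hC, ENNReal.ofReal_toReal hg.eLpNorm_ne_top]
    -- Without a solution the operator returns its default 0, so solvability need not be proved.
    · rw [invNegLaplacian, dif_neg hex]
      simp
  have hgi : MemLp g ∞ (boxMeasure X) := memLp_top_of_bound hgm K hg
  have hgn : eLpNorm g ∞ (boxMeasure X) ≤ ENNReal.ofReal K := by
    rw [eLpNorm_exponent_top]
    exact eLpNormEssSup_le_of_ae_bound hg
  have hle : ∀ C ∈ S, eLpNorm (invNegLaplacian X g) ∞ (boxMeasure X) ≤ ENNReal.ofReal (C * K) := by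
    intro C hC
    rw [ENNReal.ofReal_mul hC.1]
    exact (hC.2 g hgp hgi).trans (by gcongr)
  have hfin : eLpNorm (invNegLaplacian X g) ∞ (boxMeasure X) ≠ ∞ := by
    obtain ⟨C, hC⟩ := hne
    exact ((hle C hC).trans_lt ENNReal.ofReal_lt_top).ne
  have hreal : (eLpNorm (invNegLaplacian X g) ∞ (boxMeasure X)).toReal ≤
      invNegLaplacianNorm X * K := by
    have h1 : ∀ C ∈ S, (eLpNorm (invNegLaplacian X g) ∞ (boxMeasure X)).toReal ≤ C * K :=
      fun C hC => ENNReal.toReal_le_of_le_ofReal (mul_nonneg hC.1 hK) (hle C hC)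
    -- Passing to the infimum over `C` requires dividing by `K`, so `K = 0` is treated apart.
    rcases hK.eq_or_lt with h0 | h0
    · obtain ⟨C, hC⟩ := hne
      simpa [← h0] using h1 C hC
    · rw [← div_le_iff₀ h0]
      exact le_csInf hne fun C hC => (div_le_iff₀ h0).2 (h1 C hC)
  rw [eLpNorm_exponent_top] at hreal hfin
  filter_upwards [ae_le_eLpNormEssSup (f := invNegLaplacian X g) (μ := boxMeasure X)] with x hx
  have := ENNReal.toReal_mono hfin hx
  exact (by simpa using this : |invNegLaplacian X g x| ≤ _).trans hreal

/-! ### Pointwise bounds for the right-hand side. -/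

lemma abs_le_supNormUnit {g : ℝ → ℝ} (hg : Continuous g) {s : ℝ} (hs : s ∈ Icc (0 : ℝ) 1) :
    |g s| ≤ supNormUnit g :=
  le_csSup (isCompact_Icc.image (by fun_prop : Continuous fun s => |g s|)).bddAbove
    (mem_image_of_mem _ hs)

/-- The mean value inequality for `deriv g`. It is used with `t` an endpoint, where `W'` and `f'`
vanish. -/
lemma abs_deriv_sub_deriv_le {g : ℝ → ℝ} (hg : ContDiff ℝ 2 g) {s t : ℝ}
    (hs : s ∈ Icc (0 : ℝ) 1) (ht : t ∈ Icc (0 : ℝ) 1) :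
    |deriv g s - deriv g t| ≤ supNormUnit (iteratedDeriv 2 g) * |s - t| := by
  have h2 : iteratedDeriv 2 g = deriv (deriv g) := by
    rw [iteratedDeriv_succ, iteratedDeriv_one]
  have hd : Differentiable ℝ (deriv g) :=
    (hg.deriv' (n := 1)).differentiable (by norm_num)
  have hc : Continuous (iteratedDeriv 2 g) := hg.continuous_iteratedDeriv 2 le_rfl
  refine (convex_Icc (0 : ℝ) 1).norm_image_sub_le_of_norm_deriv_le (fun x _ => hd x)
    (fun x hx => ?_) ht hs
  rw [← h2]
  exact abs_le_supNormUnit hc hx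

lemma contDiff_W : ContDiff ℝ 2 W := by unfold W; fun_prop

lemma contDiff_f : ContDiff ℝ 2 f := by unfold f; fun_prop

lemma deriv_W (s : ℝ) : deriv W s = 36 * (s ^ 2 - s) * (2 * s - 1) := by
  have h := ((((hasDerivAt_id s).pow 2).sub (hasDerivAt_id s)).pow 2).const_mul (18 : ℝ)
  refine Eq.trans h.deriv ?_
  simp
  ring

lemma deriv_f (s : ℝ) : deriv f s = 6 * s - 6 * s ^ 2 := by
  have h := (((hasDerivAt_id s).pow 2).const_mul (3 : ℝ)).sub
    (((hasDerivAt_id s).pow 3).const_mul 2)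
  refine Eq.trans h.deriv ?_
  simp
  ring

lemma abs_f_sub_le {ω s : ℝ} (hs : s ∈ Icc (0 : ℝ) 1) : |f s - ω| ≤ omegaTilde ω := by
  obtain ⟨h0, h1⟩ := hs
  have hf0 : 0 ≤ f s := by
    have : f s = s ^ 2 * (3 - 2 * s) := by unfold f; ring
    rw [this]
    exact mul_nonneg (sq_nonneg _) (by linarith)
  have hf1 : f s ≤ 1 := by
    have : 1 - f s = (1 - s) ^ 2 * (1 + 2 * s) := by unfold f; ring
    have := mul_nonneg (sq_nonneg (1 - s)) (by linarith : 0 ≤ 1 + 2 * s)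
    linarith
  rw [abs_le, omegaTilde]
  constructor
  · linarith [le_max_left ω (1 - ω)]
  · linarith [le_max_right ω (1 - ω)]

/-- The bounds for the right-hand side at one point. -/
lemma mem_Icc_of_le_stabilization {ε κ τ A a s : ℝ} (hε : 0 < ε) (hτ : 0 < τ)
    (ha : |a| ≤ A) (hs : s ∈ Icc (0 : ℝ) 1) (hcond : LW / ε + A * Lf ≤ 1 / τ + κ / ε) :
    (1 + τ * κ / ε) * s - τ / ε * deriv W s - τ * a * deriv f s ∈ Icc 0 (1 + τ * κ / ε) := by
  have h0m : (0 : ℝ) ∈ Icc (0 : ℝ) 1 := by simp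
  have h1m : (1 : ℝ) ∈ Icc (0 : ℝ) 1 := by simp
  have hLf : 0 ≤ Lf := (abs_nonneg _).trans
    (abs_le_supNormUnit (contDiff_f.continuous_iteratedDeriv 2 le_rfl) h0m)
  have hc : τ / ε * LW + τ * (A * Lf) ≤ 1 + τ * κ / ε := by
    have h := mul_le_mul_of_nonneg_left hcond hτ.le
    have e1 : τ * (LW / ε + A * Lf) = τ / ε * LW + τ * (A * Lf) := by ring
    have e2 : τ * (1 / τ + κ / ε) = 1 + τ * κ / ε := by field_simp
    rwa [e1, e2] at h
  -- Here `r` is the distance from `s` to 0 or to 1; one estimate serves both ends.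
  have key : ∀ r : ℝ, |deriv W s| ≤ LW * r → |deriv f s| ≤ Lf * r → 0 ≤ r →
      |τ / ε * deriv W s + τ * a * deriv f s| ≤ (1 + τ * κ / ε) * r := by
    intro r h1 h2 hr
    calc |τ / ε * deriv W s + τ * a * deriv f s|
        ≤ τ / ε * |deriv W s| + τ * (|a| * |deriv f s|) := by
          refine (abs_add_le _ _).trans (le_of_eq ?_)
          rw [abs_mul, abs_mul, abs_mul, abs_of_pos hτ, abs_of_pos (div_pos hτ hε), mul_assoc]
      _ ≤ τ / ε * (LW * r) + τ * (A * (Lf * r)) := by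
          have := (abs_nonneg a).trans ha
          gcongr
      _ = (τ / ε * LW + τ * (A * Lf)) * r := by ring
      _ ≤ _ := mul_le_mul_of_nonneg_right hc hr
  have k0 := key s
    (by simpa [deriv_W 0, abs_of_nonneg hs.1, LW] using abs_deriv_sub_deriv_le contDiff_W hs h0m)
    (by simpa [deriv_f 0, abs_of_nonneg hs.1, Lf] using abs_deriv_sub_deriv_le contDiff_f hs h0m)
    hs.1
  have hs1 : |s - 1| = 1 - s := by rw [abs_sub_comm, abs_of_nonneg (sub_nonneg.2 hs.2)]
  have k1 := key (1 - s)
    (by simpa [deriv_W 1, hs1, LW] using abs_deriv_sub_deriv_le contDiff_W hs h1m)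
    (by simpa [deriv_f 1, hs1, Lf] using abs_deriv_sub_deriv_le contDiff_f hs h1m)
    (sub_nonneg.2 hs.2)
  rw [abs_le] at k0 k1
  constructor <;> linarith

/-! ### The right-hand side and the scheme. -/

lemma rhs_mem_Icc (hd : d ≤ 3) {X : Fin d → ℝ} (hX : ∀ i, 0 < X i) {ε γ M ω κ τ : ℝ}
    (hε : 0 < ε) (hγ : 0 < γ) (hM : 0 ≤ M) (hτ : 0 < τ)
    (hcond : 1 / τ + κ / ε ≥ LW / ε + omegaTilde ω * Lf *
      (γ * invNegLaplacianNorm X + M * volume.real (box X)))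
    {ψ : EuclideanSpace ℝ (Fin d) → ℝ} (hψ : IsUnitValued X ψ) :
    ∀ᵐ x ∂(boxMeasure X), rhs X ε γ M ω κ τ ψ x ∈ Icc 0 (1 + τ * κ / ε) := by
  have hfb : ∀ᵐ x ∂(boxMeasure X), |f (ψ x) - ω| ≤ omegaTilde ω := by
    filter_upwards [hψ.mem_Icc] with x hx using abs_f_sub_le hx
  have hω : 0 ≤ omegaTilde ω :=
    (abs_nonneg _).trans (abs_f_sub_le (ω := ω) (s := 0) (by simp))
  have hfc : Continuous fun s => f s - ω := contDiff_f.continuous.sub continuous_const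
  have hu := ae_abs_invNegLaplacian_le hd hX (g := fun y => f (ψ y) - ω)
    (fun i x => by simp only [hψ.periodic i x])
    (hfc.comp_aestronglyMeasurable hψ.aestronglyMeasurable) hω hfb
  have hm : |∫ y, (f (ψ y) - ω) ∂(boxMeasure X)| ≤ omegaTilde ω * volume.real (box X) := by
    have h := norm_integral_le_of_norm_le_const (μ := boxMeasure X)
      (f := fun y => f (ψ y) - ω) hfb
    rwa [boxMeasure, measureReal_restrict_apply_univ] at h
  filter_upwards [hψ.mem_Icc, hu] with x hx hux
  -- Both nonlocal terms multiply `f'(ψ)`, so they form a single coefficient `a` at the given point.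
  have ha : |γ * invNegLaplacian X (fun y => f (ψ y) - ω) x +
      M * ∫ y, (f (ψ y) - ω) ∂(boxMeasure X)| ≤
      omegaTilde ω * (γ * invNegLaplacianNorm X + M * volume.real (box X)) := by
    refine (abs_add_le _ _).trans ?_
    rw [abs_mul, abs_mul, abs_of_pos hγ, abs_of_nonneg hM]
    have h1 := mul_le_mul_of_nonneg_left hux hγ.le
    have h2 := mul_le_mul_of_nonneg_left hm hM
    linarith
  convert mem_Icc_of_le_stabilization (κ := κ) hε hτ ha hx (by linarith) using 1
  rw [rhs]
  ring

lemma isUnitValued_const (X : Fin d → ℝ) {s : ℝ} (hs : s ∈ Icc (0 : ℝ) 1) :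
    IsUnitValued X fun _ => s :=
  ⟨fun _ _ => rfl, aestronglyMeasurable_const, Filter.Eventually.of_forall fun _ => hs⟩

lemma SchemeStep.schemeStep' {X : Fin d → ℝ} {ε γ M ω κ τ : ℝ} (hτ : 0 < τ)
    {φ φ' : EuclideanSpace ℝ (Fin d) → ℝ} (h : SchemeStep X ε γ M ω κ τ φ φ') :
    SchemeStep' X ε γ M ω κ τ φ φ' := by
  obtain ⟨h1, h2, L, h3, h4, h5⟩ := h
  refine ⟨h1, h2, L, h3, h4, ?_⟩
  filter_upwards [h5] with x hx
  have e1 : τ * ((1 / τ + κ / ε) * (φ' x - φ x)) = (1 + τ * κ / ε) * (φ' x - φ x) := by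
    field_simp
  rw [hx] at e1
  rw [rhs]
  linear_combination -e1

/-- One step of the scheme preserves the bounds `0` and `1`. -/
lemma SchemeStep'.isUnitValued (hd : d ≤ 3) {X : Fin d → ℝ} (hX : ∀ i, 0 < X i)
    {ε γ M ω κ τ : ℝ} (hε : 0 < ε) (hγ : 0 < γ) (hM : 0 ≤ M) (hκ : 0 < κ) (hτ : 0 < τ)
    (hcond : 1 / τ + κ / ε ≥ LW / ε + omegaTilde ω * Lf *
      (γ * invNegLaplacianNorm X + M * volume.real (box X)))
    {φ φ' : EuclideanSpace ℝ (Fin d) → ℝ} (hφ : IsUnitValued X φ)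
    (h : SchemeStep' X ε γ M ω κ τ φ φ') : IsUnitValued X φ' := by
  obtain ⟨h1, h2, L, h3, h4, h5⟩ := h
  have hr := rhs_mem_Icc hd hX hε hγ hM hτ hcond hφ
  have hc : 0 < 1 + τ * κ / ε := by positivity
  have ha : 0 ≤ τ * ε := by positivity
  have hlo := ae_le_of_mul_le_sub_laplacian hX (m := 0) hc ha h2 h3 h4 (by
    filter_upwards [hr, h5] with x hx h5x
    rw [h5x, mul_zero]
    exact hx.1)
  have hup := ae_ge_of_sub_laplacian_le_mul hX (m := 1) hc ha h2 h3 h4 (by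
    filter_upwards [hr, h5] with x hx h5x
    rw [h5x, mul_one]
    exact hx.2)
  exact ⟨h1, h2.1, by filter_upwards [hlo, hup] with x a b using ⟨a, b⟩⟩

end PACOK

end TorusFourier


theorem mainTheorem3 {d : ℕ} (hd : d = 2 ∨ d = 3) (X : Fin d → ℝ) (hX : ∀ i, 0 < X i)
    (ε γ M ω κ T τ : ℝ) (N : ℕ) (hε : 0 < ε) (hγ : 0 < γ) (hM : 0 ≤ M) (hω : ω ∈ Set.Ioo (0 : ℝ) 1)
    (hκ : 0 < κ) (hT : 0 < T) (hN : 0 < N) (hτ : τ = T / N)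
    (hcond : 1 / τ + κ / ε ≥ PACOK.LW / ε + PACOK.omegaTilde ω * PACOK.Lf *
      (γ * PACOK.invNegLaplacianNorm X + M * MeasureTheory.volume.real (PACOK.box X))) :
    -- the maximum and the minimum of the right-hand side map over functions with values in `[0,1]`
    ((∀ ψ, PACOK.IsUnitValued X ψ → ∀ᵐ x ∂(PACOK.boxMeasure X),
        0 ≤ PACOK.rhs X ε γ M ω κ τ ψ x ∧ PACOK.rhs X ε γ M ω κ τ ψ x ≤ 1 + τ * κ / ε) ∧
      (∃ ψ, PACOK.IsUnitValued X ψ ∧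
        ∀ᵐ x ∂(PACOK.boxMeasure X), PACOK.rhs X ε γ M ω κ τ ψ x = 1 + τ * κ / ε) ∧
      (∃ ψ, PACOK.IsUnitValued X ψ ∧
        ∀ᵐ x ∂(PACOK.boxMeasure X), PACOK.rhs X ε γ M ω κ τ ψ x = 0)) ∧
    -- the scheme, in either of its two forms, preserves the maximum principle
    (∀ φ : ℕ → EuclideanSpace ℝ (Fin d) → ℝ, PACOK.IsUnitValued X (φ 0) →
      ((∀ n < N, PACOK.SchemeStep X ε γ M ω κ τ (φ n) (φ (n + 1))) ∨
        (∀ n < N, PACOK.SchemeStep' X ε γ M ω κ τ (φ n) (φ (n + 1)))) →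
      ∀ n ∈ Finset.Icc 1 N, ∀ᵐ x ∂(PACOK.boxMeasure X), 0 ≤ φ n x ∧ φ n x ≤ 1) := by
  have hd3 : d ≤ 3 := by omega
  have hτ0 : 0 < τ := hτ ▸ div_pos hT (Nat.cast_pos.2 hN)
  refine ⟨⟨fun ψ hψ => PACOK.rhs_mem_Icc hd3 hX hε hγ hM hτ0 hcond hψ,
    ⟨fun _ => 1, PACOK.isUnitValued_const X (by simp), Filter.Eventually.of_forall fun x => ?_⟩,
    ⟨fun _ => 0, PACOK.isUnitValued_const X (by simp), Filter.Eventually.of_forall fun x => ?_⟩⟩,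
    fun φ h0 hstep => ?_⟩
  -- At the constants 1 and 0 both derivatives vanish, leaving only the linear term.
  · simp [PACOK.rhs, PACOK.deriv_W, PACOK.deriv_f]
  · simp [PACOK.rhs, PACOK.deriv_W, PACOK.deriv_f]
  · have hstep' : ∀ n < N, PACOK.SchemeStep' X ε γ M ω κ τ (φ n) (φ (n + 1)) :=
      hstep.elim (fun h n hn => (h n hn).schemeStep' hτ0) id
    have hall : ∀ n ≤ N, PACOK.IsUnitValued X (φ n) := by
      intro n
      induction n with
      | zero => exact fun _ => h0
      | succ n ih =>
        exact fun hn =>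
          (hstep' n hn).isUnitValued hd3 hX hε hγ hM hκ hτ0 hcond (ih (Nat.le_of_succ_le hn))
    exact fun n hn => (hall n (Finset.mem_Icc.1 hn).2).mem_Icc
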